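/- Let $(\mathsf Z,\mathcal Z)$ be a complete separable metric space with its Borel $\sigma$-field, and let $\mathrm Q$ be a Markov kernel on it. For a probability measure $\xi$ on $\mathsf Z$, let $\mathbb E_\xi$ denote expectation under the law of the canonical Markov chain $(Z_i)_{i\ge 0}$ with kernel $\mathrm Q$ and $Z_0\sim\xi$. Assume that $\mathrm Q$ has a unique invariant probability measure $\pi$ and is uniformly geometrically ergodic with mixing time $\tau\in\mathbb N$, $\tau\ge 1$, i.e. for every $k\in\mathbb N$ $$\sup_{z,z'\in\mathsf Z}\tfrac12\|\mathrm Q^k(z,\cdot)-\mathrm Q^k(z',\cdot)\|_{\mathsf{TV}}\le (1/4)^{\lfloor k/\tau\rfloor},$$ where $\|\cdot\|_{\mathsf{TV}}$ is the total mass of the variation of a signed measure. Let $F:\mathbb R^d\times\mathsf Z\to\mathbb R$ be such that $F(x,\cdot)$ is $\pi$-integrable for every $x$ and $f(x)=\int F(x,z)\,\pi(dz)$ is differentiable on $\mathbb R^d$. Let $\nabla F(x,z)\in\mathbb R^d$ be a stochastic gradient oracle, measurable in $z$ (for instance the gradient of $F(\cdot,z)$ at $x$, although only the following two properties are required), and let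 $\sigma,\delta\in\mathbb R$ be such that for all $x\in\mathbb R^d$ and $z\in\mathsf Z$ $$\int \nabla F(x,z')\,\pi(dz')=\nabla f(x),\qquad \|\nabla F(x,z)-\nabla f(x)\|^2\le\sigma^2+\delta^2\|\nabla f(x)\|^2 .$$ Then, for every $n\ge 1$ and $x\in\mathbb R^d$, $$\mathbb E_\pi\Big[\Big\|\frac1n\sum_{i=1}^n\nabla F(x,Z_i)-\nabla f(x)\Big\|^2\Big]\le\frac{8\tau}{n}\big(\sigma^2+\delta^2\|\nabla f(x)\|^2\big),$$ and, for every probability measure $\xi$ on $(\mathsf Z,\mathcal Z)$, $$\mathbb E_\xi\Big[\Big\|\frac1n\sum_{i=1}^n\nabla F(x,Z_i)-\nabla f(x)\Big\|^2\Big]\le\frac{C_1\tau}{n}\big(\sigma^2+\delta^2\|\nabla f(x)\|^2\big),\qquad C_1=16\Big(1+\frac1{\ln^2 4}\Big).$$ -/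

import Mathlib

open MeasureTheory ProbabilityTheory
open scoped ENNReal

namespace MarkovBatch

variable {S : Type*} [MeasurableSpace S]

instance isMarkovKernel_pow (Q : Kernel S S) [IsMarkovKernel Q] (k : ℕ) :
    IsMarkovKernel (Q ^ k) := by
  induction k with
  | zero => exact inferInstanceAs (IsMarkovKernel (Kernel.id : Kernel S S))
  | succ k ih => rw [pow_succ]; exact inferInstanceAs (IsMarkovKernel ((Q ^ k) ∘ₖ Q))

/-- The total variation norm `‖μ - ν‖_TV`, i.e. the total mass of `|μ - ν|`
(so that two mutually singular probability measures are at distance `2`). -/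
noncomputable def tvNorm (μ ν : Measure S) [IsFiniteMeasure μ] [IsFiniteMeasure ν] : ℝ≥0∞ :=
  (μ.toSignedMeasure - ν.toSignedMeasure).totalVariation Set.univ

/-- The Dobrushin coefficient `sup_{z, z'} (1/2) ‖K(z, ·) - K(z', ·)‖_TV` of a Markov kernel. -/
noncomputable def dobrushin (K : Kernel S S) [IsMarkovKernel K] : ℝ≥0∞ :=
  ⨆ z : S, ⨆ z' : S, 1 / 2 * tvNorm (K z) (K z')

/-- `Q` has the unique invariant distribution `π` and is uniformly geometrically ergodic with
mixing time `τ`. In the exponent, `k / τ` is division of natural numbers, i.e. `⌊k / τ⌋`. -/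
structure UniformlyGeometricallyErgodic (Q : Kernel S S) [IsMarkovKernel Q] (π : Measure S)
    (τ : ℕ) : Prop where
  isProbabilityMeasure : IsProbabilityMeasure π
  invariant : Q.Invariant π
  unique : ∀ π' : Measure S, IsProbabilityMeasure π' → Q.Invariant π' → π' = π
  one_le_mixingTime : 1 ≤ τ
  dobrushin_pow_le : ∀ k : ℕ, dobrushin (Q ^ k) ≤ (1 / 4 : ℝ≥0∞) ^ (k / τ)

/-- The law `ℙ_ξ` on `S^ℕ` of the canonical time-homogeneous Markov chain `(Z_0, Z_1, …)`,
`Z_i ω = ω i`, with transition kernel `Q` and initial distribution `Z_0 ∼ ξ`. -/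
noncomputable def chainLaw (Q : Kernel S S) [IsMarkovKernel Q] (ξ : Measure S) :
    Measure (ℕ → S) :=
  Kernel.trajMeasure (X := fun _ : ℕ => S) ξ
    (fun n => Q.comap (fun h : (i : Finset.Iic n) → S => h ⟨n, Finset.mem_Iic.2 le_rfl⟩)
      (measurable_pi_apply _))

/-- The objective `f(x) = 𝔼_{Z ∼ π}[F(x, Z)]`. -/
noncomputable def objective {d : ℕ} (F : EuclideanSpace ℝ (Fin d) → S → ℝ) (π : Measure S)
    (x : EuclideanSpace ℝ (Fin d)) : ℝ :=
  ∫ z, F x z ∂π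

/-- The stochastic gradient `G(x, z)`, usually written `∇F(x, z)`, is an unbiased oracle
for the gradient of `f` under `π`, with noise bounded for every `z` by
`‖G(x, z) - ∇f(x)‖² ≤ σ² + δ² ‖∇f(x)‖²`.
The oracle `G` may be the actual gradient of `F(·, z)` at `x`, but need not be. -/
structure UnbiasedBoundedOracle {d : ℕ} (f : EuclideanSpace ℝ (Fin d) → ℝ)
    (G : EuclideanSpace ℝ (Fin d) → S → EuclideanSpace ℝ (Fin d)) (π : Measure S)
    (σ δ : ℝ) : Prop where
  measurable : ∀ x, Measurable (G x)
  unbiased : ∀ x, ∫ z, G x z ∂π = gradient f x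
  noise_le : ∀ z x, ‖G x z - gradient f x‖ ^ 2 ≤ σ ^ 2 + δ ^ 2 * ‖gradient f x‖ ^ 2

/-- The squared error `‖n⁻¹ ∑_{i=1}^n G(x, Z_i) - ∇f(x)‖²` of the batch average along the
trajectory `ω = (Z_0, Z_1, …)`. -/
noncomputable def batchSqError {d : ℕ} (f : EuclideanSpace ℝ (Fin d) → ℝ)
    (G : EuclideanSpace ℝ (Fin d) → S → EuclideanSpace ℝ (Fin d)) (n : ℕ)
    (x : EuclideanSpace ℝ (Fin d)) (ω : ℕ → S) : ℝ :=
  ‖((n : ℝ)⁻¹ • ∑ i ∈ Finset.Icc 1 n, G x (ω i)) - gradient f x‖ ^ 2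

end MarkovBatch

open MarkovBatch

namespace MarkovBatch

/-! ### Bounded measurable functions. -/

section Bounded

variable {S : Type*} [MeasurableSpace S] {E : Type*} [NormedAddCommGroup E] [MeasurableSpace E]
  [BorelSpace E] [SecondCountableTopology E]

/-! Put `h = G x - ∇f(x)`, which is π-centered with `‖h‖² ≤ M² = σ² + δ²‖∇f(x)‖²` at every point. By
invariance, `Q^k h (z)` is the π-average over `z'` of `Q^k h (z) - Q^k h (z')`, so it is at most `2M
(1/4)^⌊k/τ⌋` in norm, uniformly in `z`. Conditioning on `Z_i` then bounds the correlation of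
`h(Z_i)` and `h(Z_{i+k})` under any initial law (`integral_inner_chainLaw_le`). The decay factors
sum to at most `4τ/3` (`sum_range_pow_div_le`), so expanding the square gives a second moment of
order `nτM²` (`integral_norm_sum_sq_le`). Since stationarity of the chain is never needed, the
constant 8 holds for every `ξ`, and the bound with `C₁` follows from `8 ≤ C₁`. -/

lemma integrable_of_measurable_of_norm_le {μ : Measure S} [IsFiniteMeasure μ] {h : S → E} {M : ℝ}
    (hm : Measurable h) (hM : ∀ z, ‖h z‖ ≤ M) : Integrable h μ :=
  Integrable.of_bound hm.aestronglyMeasurable M (ae_of_all _ hM)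

lemma integrable_norm_sum_sq {P : Measure (ℕ → S)} [IsFiniteMeasure P] {h : S → E} {M : ℝ}
    (hm : Measurable h) (hM : ∀ z, ‖h z‖ ≤ M) (s : Finset ℕ) :
    Integrable (fun ω => ‖∑ i ∈ s, h (ω i)‖ ^ 2) P := by
  refine integrable_of_measurable_of_norm_le (M := (s.card * M) ^ 2) (by fun_prop) fun ω => ?_
  rw [Real.norm_of_nonneg (by positivity)]
  gcongr
  exact (norm_sum_le_of_le s fun i _ => hM (ω i)).trans (by simp)

end Bounded

/-! ### Total variation and contraction of centered functions. -/

section TotalVariation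

variable {S : Type*} [MeasurableSpace S]
  {E : Type*} [NormedAddCommGroup E] [NormedSpace ℝ E] [MeasurableSpace E] [BorelSpace E]
  [SecondCountableTopology E]

/-- A function bounded by `M` has integrals against `μ` and `ν` at distance at most
`M ‖μ - ν‖_TV`. -/
lemma norm_integral_sub_integral_le_tvNorm (μ ν : Measure S) [IsFiniteMeasure μ]
    [IsFiniteMeasure ν] {h : S → E} {M : ℝ} (hm : Measurable h) (hM : ∀ z, ‖h z‖ ≤ M) :
    ‖∫ z, h z ∂μ - ∫ z, h z ∂ν‖ ≤ M * (tvNorm μ ν).toReal := by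
  set s := μ.toSignedMeasure - ν.toSignedMeasure with hs
  set p := s.toJordanDecomposition.posPart
  set q := s.toJordanDecomposition.negPart
  -- The Jordan decomposition `μ - ν = p - q`, rearranged into an identity of positive measures so
  -- that integrals can be added.
  have hμν : μ + q = ν + p := by
    ext A hA
    have h1 := s.apply_eq_posPart_real_sub_negPart_real hA
    rw [hs, Measure.toSignedMeasure_sub_apply hA] at h1
    have h2 : (μ + q).real A = (ν + p).real A := by
      rw [measureReal_add_apply, measureReal_add_apply]
      linarith
    exact (measureReal_eq_measureReal_iff).1 h2
  have hint : ∀ (ρ : Measure S) [IsFiniteMeasure ρ], Integrable h ρ := fun ρ _ =>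
    integrable_of_measurable_of_norm_le hm hM
  have heq : ∫ z, h z ∂μ - ∫ z, h z ∂ν = ∫ z, h z ∂p - ∫ z, h z ∂q := by
    have h3 : ∫ z, h z ∂(μ + q) = ∫ z, h z ∂(ν + p) := by rw [hμν]
    rw [integral_add_measure (hint _) (hint _), integral_add_measure (hint _) (hint _)] at h3
    rw [sub_eq_sub_iff_add_eq_add, h3, add_comm]
  have htv : (tvNorm μ ν).toReal = p.real Set.univ + q.real Set.univ := by
    rw [tvNorm, SignedMeasure.totalVariation, ← measureReal_def, measureReal_add_apply]
  rw [heq, htv, mul_add]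
  exact (norm_sub_le _ _).trans (add_le_add
    (norm_integral_le_of_norm_le_const (ae_of_all _ hM))
    (norm_integral_le_of_norm_le_const (ae_of_all _ hM)))

lemma tvNorm_toReal_le_of_dobrushin_le {K : Kernel S S} [IsMarkovKernel K] {c : ℝ≥0∞}
    (hc : c ≠ ∞) (hK : dobrushin K ≤ c) (z z' : S) :
    (tvNorm (K z) (K z')).toReal ≤ 2 * c.toReal := by
  have h1 : 1 / 2 * tvNorm (K z) (K z') ≤ c :=
    (le_iSup₂ (f := fun z z' => 1 / 2 * tvNorm (K z) (K z')) z z').trans hK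
  have h2 := ENNReal.toReal_mono hc h1
  rw [ENNReal.toReal_mul] at h2
  norm_num at h2
  linarith

/-- Under an invariant measure with `∫ h ∂π = 0`, the Dobrushin coefficient controls `K h`. -/
lemma norm_integral_kernel_le_of_dobrushin_le [CompleteSpace E] {K : Kernel S S} [IsMarkovKernel K]
    {π : Measure S} [IsProbabilityMeasure π] (hπ : K.Invariant π) {c : ℝ≥0∞} (hc : c ≠ ∞)
    (hK : dobrushin K ≤ c) {h : S → E} {M : ℝ} (hm : Measurable h) (hM : ∀ z, ‖h z‖ ≤ M)
    (h0 : ∫ z, h z ∂π = 0) (z : S) :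
    ‖∫ y, h y ∂(K z)‖ ≤ 2 * M * c.toReal := by
  have hM0 : 0 ≤ M := (norm_nonneg _).trans (hM z)
  have hKm : Measurable fun z' => ∫ y, h y ∂(K z') :=
    (hm.stronglyMeasurable.integral_kernel (κ := K)).measurable
  have hKb : ∀ z', ‖∫ y, h y ∂(K z')‖ ≤ M := fun z' => by
    simpa using norm_integral_le_of_norm_le_const (μ := K z') (ae_of_all _ hM)
  have hcomp : ∫ z', ∫ y, h y ∂(K z') ∂π = 0 := by
    have hi : Integrable h ((K ∘ₖ Kernel.const S π) z) :=
      integrable_of_measurable_of_norm_le hm hM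
    have := Kernel.integral_comp hi
    rw [hπ.comp_const, Kernel.const_apply, h0] at this
    exact this.symm
  have heq : ∫ y, h y ∂(K z) = ∫ z', (∫ y, h y ∂(K z) - ∫ y, h y ∂(K z')) ∂π := by
    rw [integral_sub (integrable_const _) (integrable_of_measurable_of_norm_le hKm hKb), hcomp]
    simp
  rw [heq]
  have hle : ∀ z', ‖∫ y, h y ∂(K z) - ∫ y, h y ∂(K z')‖ ≤ 2 * M * c.toReal := fun z' =>
    (norm_integral_sub_integral_le_tvNorm _ _ hm hM).trans <| by
      have := mul_le_mul_of_nonneg_left (tvNorm_toReal_le_of_dobrushin_le hc hK z z') hM0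
      linarith
  simpa using norm_integral_le_of_norm_le_const (μ := π) (ae_of_all _ hle)

end TotalVariation

/-! ### Two-time marginals of the canonical chain. -/

section Chain

variable {S : Type*} [MeasurableSpace S]

lemma invariant_pow {Q : Kernel S S} {π : Measure S} (hπ : Q.Invariant π) (k : ℕ) :
    (Q ^ k).Invariant π := by
  induction k with
  | zero => exact Measure.id_comp
  | succ k ih => rw [pow_succ]; exact ih.comp hπ

instance isProbabilityMeasure_chainLaw (Q : Kernel S S) [IsMarkovKernel Q] (ξ : Measure S)
    [IsProbabilityMeasure ξ] : IsProbabilityMeasure (chainLaw Q ξ) := by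
  unfold chainLaw
  infer_instance

/-- The Markov property of the canonical chain over one step. -/
lemma lintegral_chainLaw_succ (Q : Kernel S S) [IsMarkovKernel Q] (ξ : Measure S)
    [IsProbabilityMeasure ξ] {i j : ℕ} (hij : i ≤ j) {g : S × S → ℝ≥0∞} (hg : Measurable g) :
    ∫⁻ ω, g (ω i, ω (j + 1)) ∂(chainLaw Q ξ) =
      ∫⁻ ω, ∫⁻ z, g (ω i, z) ∂(Q (ω j)) ∂(chainLaw Q ξ) := by
  let φ : ((n : Finset.Iic j) → S) × S → ℝ≥0∞ := fun p => g (p.1 ⟨i, Finset.mem_Iic.2 hij⟩, p.2)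
  have hφ : Measurable φ := by fun_prop
  -- The law of `Z_{j+1}` given the whole past up to `j`; the transition only reads the last
  -- coordinate.
  have hstep := Kernel.map_frestrictLe_trajMeasure_compProd_eq_map_trajMeasure
    (X := fun _ : ℕ => S) (μ₀ := ξ) (a := j)
    (κ := fun n => Q.comap (fun h : (i : Finset.Iic n) → S => h ⟨n, Finset.mem_Iic.2 le_rfl⟩)
      (measurable_pi_apply _))
  have h := congrArg (fun m => ∫⁻ p, φ p ∂m) hstep
  beta_reduce at h
  rw [Measure.lintegral_compProd hφ, lintegral_map hφ (by fun_prop),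
    lintegral_map (hφ.lintegral_kernel_prod_right') (by fun_prop)] at h
  exact h.symm

/-- The pair `(Z_i, Z_{i+k})` has the law of `Z_i` followed by a `k`-step transition. -/
lemma map_chainLaw_prodMk (Q : Kernel S S) [IsMarkovKernel Q] (ξ : Measure S)
    [IsProbabilityMeasure ξ] (i k : ℕ) :
    (chainLaw Q ξ).map (fun ω => (ω i, ω (i + k))) =
      (chainLaw Q ξ).map (fun ω => ω i) ⊗ₘ (Q ^ k) := by
  induction k with
  | zero =>
    refine Measure.ext_of_lintegral _ fun g hg => ?_
    rw [lintegral_map hg (by fun_prop), Measure.lintegral_compProd hg,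
      lintegral_map (hg.lintegral_kernel_prod_right') (by fun_prop)]
    refine lintegral_congr fun ω => ?_
    rw [pow_zero]
    change _ = ∫⁻ b, g (ω i, b) ∂(Kernel.id (ω i))
    rw [Kernel.id_apply, lintegral_dirac' _ (by fun_prop)]
    rfl
  | succ k ih =>
    refine Measure.ext_of_lintegral _ fun g hg => ?_
    have hg' : Measurable fun p : S × S => ∫⁻ z, g (p.1, z) ∂(Q p.2) :=
      Measurable.lintegral_kernel_prod_right' (κ := Q.comap Prod.snd measurable_snd)
        (f := fun p : (S × S) × S => g (p.1.1, p.2)) (by fun_prop)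
    -- The induction hypothesis is tested on `g` averaged over one more step from the second
    -- coordinate.
    have h := congrArg (fun m => ∫⁻ p : S × S, ∫⁻ z, g (p.1, z) ∂(Q p.2) ∂m) ih
    beta_reduce at h
    rw [lintegral_map hg' (by fun_prop), Measure.lintegral_compProd hg'] at h
    rw [lintegral_map hg (by fun_prop), Measure.lintegral_compProd hg, ← add_assoc,
      lintegral_chainLaw_succ Q ξ (Nat.le_add_right i k) hg, h]
    refine lintegral_congr fun a => ?_
    rw [pow_succ']
    exact (Kernel.lintegral_comp Q (Q ^ k) a (g := fun z => g (a, z)) (by fun_prop)).symm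

end Chain

/-! ### Decay of correlations and second moments. -/

section Correlation

variable {S : Type*} [MeasurableSpace S]
  {E : Type*} [NormedAddCommGroup E] [InnerProductSpace ℝ E] [CompleteSpace E]
  [MeasurableSpace E] [BorelSpace E] [SecondCountableTopology E]

/-- Conditioning on `Z_i` replaces `h(Z_{i+k})` by `Q^k h (Z_i)`, whose bound is uniform in the
state; hence the law of `Z_i` plays no role. -/
lemma integral_inner_chainLaw_le {Q : Kernel S S} [IsMarkovKernel Q] {π : Measure S} {τ : ℕ}
    (hQ : UniformlyGeometricallyErgodic Q π τ) (ξ : Measure S) [IsProbabilityMeasure ξ]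
    {h : S → E} {M : ℝ} (hm : Measurable h) (hM : ∀ z, ‖h z‖ ≤ M) (h0 : ∫ z, h z ∂π = 0)
    (i k : ℕ) :
    ∫ ω, inner ℝ (h (ω i)) (h (ω (i + k))) ∂(chainLaw Q ξ) ≤
      2 * M ^ 2 * (1 / 4 : ℝ) ^ (k / τ) := by
  have := hQ.isProbabilityMeasure
  let μ := (chainLaw Q ξ).map (fun ω => ω i)
  have : IsProbabilityMeasure μ := 
    Measure.isProbabilityMeasure_map (measurable_pi_apply i).aemeasurable
  let φ : S × S → ℝ := fun p => inner ℝ (h p.1) (h p.2)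
  have hφ : Measurable φ := (hm.comp measurable_fst).inner (hm.comp measurable_snd)
  have hφM : ∀ p, ‖φ p‖ ≤ M * M := fun p =>
    (norm_inner_le_norm _ _).trans (mul_le_mul (hM _) (hM _) (norm_nonneg _)
      ((norm_nonneg _).trans (hM p.1)))
  have heq : ∫ ω, inner ℝ (h (ω i)) (h (ω (i + k))) ∂(chainLaw Q ξ) =
      ∫ a, inner ℝ (h a) (∫ b, h b ∂((Q ^ k) a)) ∂μ := by
    calc ∫ ω, inner ℝ (h (ω i)) (h (ω (i + k))) ∂(chainLaw Q ξ)
        = ∫ p, φ p ∂((chainLaw Q ξ).map (fun ω => (ω i, ω (i + k)))) :=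
          (integral_map (φ := fun ω : ℕ → S => (ω i, ω (i + k)))
            ((measurable_pi_apply i).prodMk (measurable_pi_apply (i + k))).aemeasurable
            hφ.aestronglyMeasurable).symm
      _ = ∫ a, ∫ b, φ (a, b) ∂((Q ^ k) a) ∂μ := by
          rw [map_chainLaw_prodMk,
            Measure.integral_compProd (integrable_of_measurable_of_norm_le hφ hφM)]
      _ = _ := integral_congr_ae (ae_of_all _ fun a =>
          integral_inner (integrable_of_measurable_of_norm_le hm hM) (h a))
  have hbound : ∀ a, ‖(inner ℝ (h a) (∫ b, h b ∂((Q ^ k) a)) : ℝ)‖ ≤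
      2 * M ^ 2 * (1 / 4 : ℝ) ^ (k / τ) := fun a => by
    have h1 := norm_integral_kernel_le_of_dobrushin_le (invariant_pow hQ.invariant k)
      (by finiteness) (hQ.dobrushin_pow_le k) hm hM h0 a
    rw [ENNReal.toReal_pow] at h1
    norm_num at h1
    have h2 : (0 : ℝ) ≤ M := (norm_nonneg _).trans (hM a)
    calc ‖(inner ℝ (h a) (∫ b, h b ∂((Q ^ k) a)) : ℝ)‖
        ≤ ‖h a‖ * ‖∫ b, h b ∂((Q ^ k) a)‖ := norm_inner_le_norm _ _
      _ ≤ M * (2 * M * (1 / 4 : ℝ) ^ (k / τ)) :=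
          mul_le_mul (hM a) (by simpa using h1) (norm_nonneg _) h2
      _ = _ := by ring
  rw [heq]
  refine (Real.le_norm_self _).trans ?_
  simpa using norm_integral_le_of_norm_le_const (μ := μ) (ae_of_all _ hbound)

/-- The summand is constant on blocks of length `τ`, so full blocks form `τ` copies of a geometric
series of ratio 1/4. -/
lemma sum_range_pow_div_le {τ : ℕ} (hτ : 1 ≤ τ) (N : ℕ) :
    ∑ k ∈ Finset.range N, (1 / 4 : ℝ) ^ (k / τ) ≤ 4 / 3 * τ := by
  have hblock : ∀ m : ℕ, ∑ k ∈ Finset.range (τ * m), (1 / 4 : ℝ) ^ (k / τ) =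
      4 / 3 * τ * (1 - (1 / 4) ^ m) := by
    intro m
    induction m with
    | zero => simp
    | succ m ih =>
      have hconst : ∀ y ∈ Finset.range τ,
          (1 / 4 : ℝ) ^ ((τ * m + y) / τ) = (1 / 4) ^ m := fun y hy => by
        rw [Nat.mul_add_div (by lia), Nat.div_eq_of_lt (Finset.mem_range.1 hy), add_zero]
      rw [mul_add_one, Finset.sum_range_add, ih, Finset.sum_congr rfl hconst]
      simp only [Finset.sum_const, Finset.card_range, nsmul_eq_mul]
      ring
  calc ∑ k ∈ Finset.range N, (1 / 4 : ℝ) ^ (k / τ)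
      ≤ ∑ k ∈ Finset.range (τ * N), (1 / 4 : ℝ) ^ (k / τ) :=
        Finset.sum_le_sum_of_subset_of_nonneg
          (Finset.range_mono (Nat.le_mul_of_pos_left N hτ)) (fun _ _ _ => by positivity)
    _ = 4 / 3 * τ * (1 - (1 / 4) ^ N) := hblock N
    _ ≤ 4 / 3 * τ := by
        have : (0 : ℝ) ≤ 4 / 3 * τ * (1 / 4) ^ N := by positivity
        linarith

/-- The second moment of the partial sums of a bounded centered function along the chain, for an
arbitrary initial distribution. -/
lemma integral_norm_sum_sq_le {Q : Kernel S S} [IsMarkovKernel Q] {π : Measure S} {τ : ℕ}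
    (hQ : UniformlyGeometricallyErgodic Q π τ) (ξ : Measure S) [IsProbabilityMeasure ξ]
    {h : S → E} {M : ℝ} (hm : Measurable h) (hM : ∀ z, ‖h z‖ ≤ M) (h0 : ∫ z, h z ∂π = 0)
    (n : ℕ) :
    ∫ ω, ‖∑ i ∈ Finset.Icc 1 n, h (ω i)‖ ^ 2 ∂(chainLaw Q ξ) ≤ 8 * τ * n * M ^ 2 := by
  induction n with
  | zero => simp
  | succ n ih =>
    set P := chainLaw Q ξ
    have hinner : ∀ i j, Integrable (fun ω : ℕ → S => (inner ℝ (h (ω i)) (h (ω j)) : ℝ)) P :=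
      fun i j => integrable_of_measurable_of_norm_le (M := M * M) (by fun_prop) fun ω =>
        (norm_inner_le_norm _ _).trans (mul_le_mul (hM _) (hM _) (norm_nonneg _)
          ((norm_nonneg _).trans (hM (ω i))))
    have hsq : Integrable (fun ω : ℕ → S => ‖h (ω (n + 1))‖ ^ 2) P := by
      simpa using integrable_norm_sum_sq (P := P) hm hM {n + 1}
    have hcross : Integrable (fun ω : ℕ → S =>
        2 * ∑ i ∈ Finset.Icc 1 n, (inner ℝ (h (ω i)) (h (ω (n + 1))) : ℝ)) P :=
      (integrable_finsetSum _ fun i _ => hinner i (n + 1)).const_mul 2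
    have hexp : ∀ ω : ℕ → S, ‖∑ i ∈ Finset.Icc 1 (n + 1), h (ω i)‖ ^ 2 =
        ‖∑ i ∈ Finset.Icc 1 n, h (ω i)‖ ^ 2 +
          2 * ∑ i ∈ Finset.Icc 1 n, (inner ℝ (h (ω i)) (h (ω (n + 1))) : ℝ) +
          ‖h (ω (n + 1))‖ ^ 2 := fun ω => by
      rw [Finset.sum_Icc_succ_top (by lia), norm_add_sq_real, sum_inner]
    have hdiag : ∫ ω, ‖h (ω (n + 1))‖ ^ 2 ∂P ≤ M ^ 2 := by
      have : ∫ ω, ‖h (ω (n + 1))‖ ^ 2 ∂P ≤ ∫ _, M ^ 2 ∂P :=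
        integral_mono hsq (integrable_const _) fun ω =>
          pow_le_pow_left₀ (norm_nonneg _) (hM _) 2
      simpa using this
    -- The `-1` removes the lag 0 term, since the diagonal is bounded separately by `hdiag`.
    have hsum : ∑ i ∈ Finset.Icc 1 n, (1 / 4 : ℝ) ^ ((n + 1 - i) / τ) ≤ 4 / 3 * τ - 1 := by
      have h1 := sum_range_pow_div_le hQ.one_le_mixingTime (n + 1)
      rw [Finset.sum_range_succ'] at h1
      have h2 : ∑ i ∈ Finset.Icc 1 n, (1 / 4 : ℝ) ^ ((n + 1 - i) / τ) =
          ∑ k ∈ Finset.range n, (1 / 4 : ℝ) ^ ((k + 1) / τ) := by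
        refine Finset.sum_nbij' (fun i => n - i) (fun k => n - k) ?_ ?_ ?_ ?_ ?_
        · intro i hi; simp at hi ⊢; lia
        · intro i hi; simp at hi ⊢; lia
        · intro i hi; simp at hi ⊢; lia
        · intro i hi; simp at hi ⊢; lia
        · intro i hi
          simp only [Finset.mem_Icc] at hi
          rw [show n + 1 - i = n - i + 1 by lia]
      simp only [Nat.zero_div, pow_zero] at h1
      linarith
    have hcorr : ∑ i ∈ Finset.Icc 1 n, ∫ ω, (inner ℝ (h (ω i)) (h (ω (n + 1))) : ℝ) ∂P ≤
        2 * M ^ 2 * (4 / 3 * τ - 1) := by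
      calc _ ≤ ∑ i ∈ Finset.Icc 1 n, 2 * M ^ 2 * (1 / 4 : ℝ) ^ ((n + 1 - i) / τ) := by
            refine Finset.sum_le_sum fun i hi => ?_
            have := integral_inner_chainLaw_le hQ ξ hm hM h0 i (n + 1 - i)
            rwa [Nat.add_sub_cancel' (by simp at hi; lia)] at this
        _ ≤ _ := by
            rw [← Finset.mul_sum]
            exact mul_le_mul_of_nonneg_left hsum (by positivity)
    have hsumsq : Integrable (fun ω => ‖∑ i ∈ Finset.Icc 1 n, h (ω i)‖ ^ 2) P :=
      integrable_norm_sum_sq hm hM _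
    have hsumcross : Integrable (fun ω => ‖∑ i ∈ Finset.Icc 1 n, h (ω i)‖ ^ 2 +
        2 * ∑ i ∈ Finset.Icc 1 n, (inner ℝ (h (ω i)) (h (ω (n + 1))) : ℝ)) P :=
      hsumsq.add hcross
    simp_rw [hexp]
    rw [integral_add hsumcross hsq, integral_add hsumsq hcross, integral_const_mul,
      integral_finsetSum _ fun i _ => hinner i (n + 1)]
    have hτM : 0 ≤ (τ : ℝ) * M ^ 2 := by positivity
    push_cast
    -- The increment is at most `M² + 4M²(4τ/3 - 1) = (16τ/3 - 3)M² ≤ 8τM²`.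
    nlinarith [sq_nonneg M]

end Correlation

/-! ### From partial sums to the batch gradient. -/

section Batch

variable {S : Type*} [MeasurableSpace S]

lemma integral_batchSqError_le {Q : Kernel S S} [IsMarkovKernel Q] {π : Measure S} {τ : ℕ}
    (hQ : UniformlyGeometricallyErgodic Q π τ) {d : ℕ} {f : EuclideanSpace ℝ (Fin d) → ℝ}
    {G : EuclideanSpace ℝ (Fin d) → S → EuclideanSpace ℝ (Fin d)} {σ δ : ℝ}
    (hG : UnbiasedBoundedOracle f G π σ δ) {n : ℕ} (hn : 1 ≤ n) (x : EuclideanSpace ℝ (Fin d))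
    (ξ : Measure S) [IsProbabilityMeasure ξ] :
    Integrable (batchSqError f G n x) (chainLaw Q ξ) ∧
      ∫ ω, batchSqError f G n x ω ∂(chainLaw Q ξ) ≤
        8 * (τ : ℝ) / (n : ℝ) * (σ ^ 2 + δ ^ 2 * ‖gradient f x‖ ^ 2) := by
  have := hQ.isProbabilityMeasure
  set v := gradient f x with hv
  set B := σ ^ 2 + δ ^ 2 * ‖v‖ ^ 2 with hB
  have hB0 : 0 ≤ B := by positivity
  have hn0 : (n : ℝ) ≠ 0 := by positivity
  let h : S → EuclideanSpace ℝ (Fin d) := fun z => G x z - v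
  have hm : Measurable h := (hG.measurable x).sub_const v
  have hM : ∀ z, ‖h z‖ ≤ √B := fun z => Real.le_sqrt_of_sq_le (hG.noise_le z x)
  have h0 : ∫ z, h z ∂π = 0 := by
    have hGi : Integrable (G x) π :=
      ((integrable_of_measurable_of_norm_le (μ := π) hm hM).add (integrable_const v)).congr
        (ae_of_all _ fun z => sub_add_cancel (G x z) v)
    rw [integral_sub hGi (integrable_const v), hG.unbiased x]
    simp [hv]
  have heq : batchSqError f G n x =
      fun ω => ((n : ℝ)⁻¹) ^ 2 * ‖∑ i ∈ Finset.Icc 1 n, h (ω i)‖ ^ 2 := by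
    funext ω
    have : ((n : ℝ)⁻¹ • ∑ i ∈ Finset.Icc 1 n, G x (ω i)) - v =
        (n : ℝ)⁻¹ • ∑ i ∈ Finset.Icc 1 n, h (ω i) := by
      simp only [h, Finset.sum_sub_distrib, Finset.sum_const, Nat.card_Icc, Nat.add_sub_cancel,
        smul_sub, ← Nat.cast_smul_eq_nsmul ℝ, smul_smul, inv_mul_cancel₀ hn0, one_smul]
    rw [batchSqError, ← hv, this, norm_smul, mul_pow, Real.norm_of_nonneg (by positivity)]
  rw [heq]
  refine ⟨(integrable_norm_sum_sq hm hM _).const_mul _, ?_⟩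
  rw [integral_const_mul]
  calc ((n : ℝ)⁻¹) ^ 2 * ∫ ω, ‖∑ i ∈ Finset.Icc 1 n, h (ω i)‖ ^ 2 ∂(chainLaw Q ξ)
      ≤ ((n : ℝ)⁻¹) ^ 2 * (8 * τ * n * √B ^ 2) :=
        mul_le_mul_of_nonneg_left (integral_norm_sum_sq_le hQ ξ hm hM h0 n) (by positivity)
    _ = 8 * (τ : ℝ) / (n : ℝ) * B := by
        rw [Real.sq_sqrt hB0]
        field_simp

end Batch

end MarkovBatch

theorem mainTheorem12 {S : Type*} [MetricSpace S] [CompleteSpace S]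
    [TopologicalSpace.SeparableSpace S] [MeasurableSpace S] [BorelSpace S]
    (Q : Kernel S S) [IsMarkovKernel Q] (π : Measure S) (τ : ℕ)
    (hQ : UniformlyGeometricallyErgodic Q π τ)
    {d : ℕ} (F : EuclideanSpace ℝ (Fin d) → S → ℝ)
    (hF : ∀ x, Integrable (F x) π)
    (hf : Differentiable ℝ (objective F π))
    (G : EuclideanSpace ℝ (Fin d) → S → EuclideanSpace ℝ (Fin d)) (σ δ : ℝ)
    (hG : UnbiasedBoundedOracle (objective F π) G π σ δ)
    (n : ℕ) (hn : 1 ≤ n) (x : EuclideanSpace ℝ (Fin d)) :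
    (Integrable (batchSqError (objective F π) G n x) (chainLaw Q π) ∧
      ∫ ω, batchSqError (objective F π) G n x ω ∂(chainLaw Q π) ≤
        8 * (τ : ℝ) / (n : ℝ) * (σ ^ 2 + δ ^ 2 * ‖gradient (objective F π) x‖ ^ 2)) ∧
    ∀ ξ : Measure S, IsProbabilityMeasure ξ →
      Integrable (batchSqError (objective F π) G n x) (chainLaw Q ξ) ∧
      ∫ ω, batchSqError (objective F π) G n x ω ∂(chainLaw Q ξ) ≤
        16 * (1 + 1 / Real.log 4 ^ 2) * (τ : ℝ) / (n : ℝ) *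
          (σ ^ 2 + δ ^ 2 * ‖gradient (objective F π) x‖ ^ 2) := by
  have := hQ.isProbabilityMeasure
  refine ⟨integral_batchSqError_le hQ hG hn x π, fun ξ _ => ?_⟩
  obtain ⟨hint, hle⟩ := integral_batchSqError_le hQ hG hn x ξ
  refine ⟨hint, hle.trans ?_⟩
  gcongr
  have : 0 ≤ 1 / Real.log 4 ^ 2 := by positivity
  linarith
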